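/- Let $q$ be a prime power, $\delta\ge 0$ and $1\le N\le K$. A server holds $N$ files $X_1,\dots,X_N$ and serves $K$ users over a shared link. In the Chen–Fan–Letaief (CFL) prefetching scheme $\mathcal M_{\mathrm{CFL}}$ for cache size $M=1/K$ (in units of one file), every file is divided into $n_{\mathrm{CFL}}$ subfiles, $X_i=(X_{i,1},\dots,X_{i,n_{\mathrm{CFL}}})$, each regarded as a symbol of $\mathbb F_q$. If $N=K$, then $n_{\mathrm{CFL}}=N$ and user $k$ caches $X_{1,k}+\dots+X_{N,k}$. If $N<K$, then $n_{\mathrm{CFL}}=NK$ and user $k$ caches $X_{1,N(k-1)+j}+\dots+X_{N,N(k-1)+j}$ for $j=1,\dots,N$. For a demand $\mathbf d\in\{1,\dots,N\}^K$, a linear delivery of length $\ell$ transmits $\ell$ $\mathbb F_q$-linear combinations of the subfiles. It is $\delta$-error-correcting if every user $k$ can recover $X_{d_k}$ from its cache and the received word whenever at most $\delta$ transmissions are in error. Its rate is $\ell$ divided by the number of subfiles per file. Let $R^*(\mathbf d,\mathcal M,\delta)$ be the minimum rate of such a delivery for the prefetching scheme $\mathcal M$, and $R^*(\mathcal M,\delta)=\mathbb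 E_{\mathbf d}[R^*(\mathbf d,\mathcal M,\delta)]$ its expectation over uniformly distributed $\mathbf d$. Let $\kappa(\mathcal M_{\mathrm{CFL}},\mathbf d)$ be the min-rank of the index coding problem with one receiver for each user $k$ and each subfile $X_{d_k,s}$ of its requested file, having the cache of user $k$ as side information: the least rank of $A+R$, where the rows of $R$ are the request vectors and $A$ ranges over the matrices whose row for each receiver lies in the row space of its side-information matrix. Let $N_q[k,d]$ be the length of a shortest linear code over $\mathbb F_q$ with dimension $k$ and minimum distance $d$ (with $N_q[0,d]=0$). Then: (1) For $M=1/K$, $$R^*(\mathcal M_{\mathrm{CFL}},\delta)=\mathbb E_{\mathbf d}\left[\frac{N_q[\kappa(\mathcal M_{\mathrm{CFL}},\mathbf d),2\delta+1]}{n_{\mathrm{CFL}}}\right],$$ and for every $\mathbf d$ the minimum rate is attained and equals $N_q[\kappa(\mathcal M_{\mathrm{CFL}},\mathbf d),2\delta+1]/n_{\mathrm{CFL}}$. (2) For every $\mathbf d$ this rate is attained by the concatenation of the CFL delivery with any optimal code, that is, any linear code of dimension $\kappa=\kappa(\mathcal M_{\mathrm{CFL}},\mathbf d)$, minimum distance $2\delta+1$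 and length $N_q[\kappa,2\delta+1]$ (such a code exists). Here the CFL delivery is the following (error-free) delivery of length $\kappa$. If not all files are demanded, it sends all subfiles of the demanded files. If all files are demanded, then for every user $k$ and every subfile position $p$ cached by $k$ it sends $X_{n,p}$ for all $n\ne d_k$ and, if some user before $k$ has the same demand, also $X_{d_k,p}+X_{d_k,p'}$, where $p'$ is the corresponding position of the first user with that demand. (3) For $M\in[0,1/K]$ use memory sharing: the fraction $KM$ of every file is prefetched by the CFL scheme, and the remaining fraction, divided into $s\ge1$ subfiles, is not cached. Every transmission is a linear combination of packets of one of the two parts (whose packets have different sizes), and every user must recover both parts of its file whenever at most $\delta$ of all transmissions are in error. The rate is the total amount transmitted, in units of one file. Then, for every $s$, the expected minimum rate at cache size $M$ is the lower convex envelope, evaluated at $M$, of its values at $M=0$ and $M=1/K$; these values are the expected minimum rate with no caching and $R^*(\mathcal M_{\mathrm{CFL}},\delta)$, respectively. -/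

import Mathlib

open scoped BigOperators Matrix

/-- A linear code `C ≤ F^n` has minimum (Hamming) distance `d`: the least weight of a nonzero
codeword is `d`. The zero code, which has no nonzero codeword, is by convention admitted for
every `d`. -/
def HasMinDist {F : Type*} [Field F] [DecidableEq F] {n : ℕ}
    (C : Submodule F (Fin n → F)) (d : ℕ) : Prop :=
  C = ⊥ ∨ IsLeast {w : ℕ | ∃ c ∈ C, c ≠ 0 ∧ hammingNorm c = w} d

/-- `N_q[k, d]`: the length of a shortest linear code over `F = 𝔽_q` of dimension `k` and minimum
distance `d`. -/
noncomputable def shortestLength (F : Type*) [Field F] [DecidableEq F] (k d : ℕ) : ℕ :=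
  sInf {n : ℕ | ∃ C : Submodule F (Fin n → F), Module.finrank F C = k ∧ HasMinDist C d}

/-- `G` is a generator matrix of a linear code of length `n`, dimension the number of rows of `G`,
and minimum distance `d`. -/
def IsGeneratorMatrix {F : Type*} [Field F] [DecidableEq F] {T : Type*} {n : ℕ}
    (G : Matrix T (Fin n) F) (d : ℕ) : Prop :=
  LinearIndependent F G.row ∧ HasMinDist (Submodule.span F (Set.range G.row)) d

/-- A generalized index coding problem over `F`, with messages indexed by `ι` and receivers indexed
by `ρ`: receiver `i` wants the packet `request i ⬝ x` and possesses the packets `side i *ᵥ x`. -/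
structure GIC (F : Type*) (ι ρ : Type*) (σ : ρ → Type*) where
  request : Matrix ρ ι F
  side : (i : ρ) → Matrix (σ i) ι F

/-- The min-rank `κ(I)`: the least rank of `A + R` over all matrices `A` whose `i`-th row lies in
the row space of the side information of receiver `i`. -/
noncomputable def GIC.minRank {F : Type*} [Field F] {ι ρ : Type*} [Fintype ι] {σ : ρ → Type*}
    (I : GIC F ι ρ σ) : ℕ :=
  sInf {r : ℕ | ∃ A : Matrix ρ ι F,
    (∀ i, A.row i ∈ Submodule.span F (Set.range (I.side i).row)) ∧ (A + I.request).rank = r}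

/-- A linear prefetching scheme for `N` files and `K` users. Every file consists of subfiles indexed
by `S`, each one a symbol of `F`, and user `k` caches the packets `P k *ᵥ x`, indexed by `C`, where
`x (n, s)` is subfile `s` of file `n`. -/
abbrev Prefetching (F : Type*) (N K : ℕ) (S C : Type*) := Fin K → Matrix C (Fin N × S) F

/-- The index coding problem induced by the demand `d`: user `k` is split into one receiver for each
subfile of the file `d k`, and every such receiver has the cache of user `k`. -/
def inducedGIC {F : Type*} [Field F] {N K : ℕ} {S C : Type*} [DecidableEq S]
    (P : Prefetching F N K S C) (d : Fin K → Fin N) :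
    GIC F (Fin N × S) (Fin K × S) (fun _ => C) where
  request := fun r => Pi.single (d r.1, r.2) 1
  side := fun r => P r.1

/-- The linear delivery `x ↦ x ᵥ* L`, with transmissions indexed by `T`, is `δ`-error-correcting for
the demand `d`: from its cache and the received word, every user recovers all of its requested file,
whenever at most `δ` of the transmissions are in error. -/
def IsDelivery {F : Type*} [Field F] [DecidableEq F] {N K : ℕ} {S C T : Type*}
    [Fintype S] [Fintype T] (P : Prefetching F N K S C) (d : Fin K → Fin N) (δ : ℕ)
    (L : Matrix (Fin N × S) T F) : Prop :=
  ∀ k : Fin K, ∃ D : (C → F) → (T → F) → (S → F),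
    ∀ (x : Fin N × S → F) (e : T → F), hammingNorm e ≤ δ →
      D (P k *ᵥ x) (x ᵥ* L + e) = fun s => x (d k, s)

/-- The rates, in units of one file, of the linear `δ`-error-correcting deliveries for `d`. -/
def deliveryRates {F : Type*} [Field F] [DecidableEq F] {N K : ℕ} {S C : Type*}
    [Fintype S] (P : Prefetching F N K S C) (d : Fin K → Fin N) (δ : ℕ) : Set ℝ :=
  {r : ℝ | ∃ (l : ℕ) (L : Matrix (Fin N × S) (Fin l) F),
    IsDelivery P d δ L ∧ r = (l : ℝ) / (Fintype.card S : ℝ)}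

/-- `R*(d, P, δ)`: the minimum achievable rate for the demand `d`. -/
noncomputable def minRate {F : Type*} [Field F] [DecidableEq F] {N K : ℕ} {S C : Type*}
    [Fintype S] (P : Prefetching F N K S C) (d : Fin K → Fin N) (δ : ℕ) : ℝ :=
  sInf (deliveryRates P d δ)

/-- `R*(P, δ)`: the expectation of the minimum rate under a uniformly random demand. -/
noncomputable def avgRate {F : Type*} [Field F] [DecidableEq F] {N K : ℕ} {S C : Type*}
    [Fintype S] (P : Prefetching F N K S C) (δ : ℕ) : ℝ :=
  𝔼 d : Fin K → Fin N, minRate P d δ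

/-- Memory sharing between two prefetching schemes `P` and `P'`. Every file has a first part,
prefetched by `P`, and a second part, prefetched by `P'`. The packets of the two parts have different
sizes, so every transmission is a linear combination of packets of one of the parts. Every user has
to recover both parts of its requested file whenever at most `δ` of all the transmissions are in
error. -/
def IsSharedDelivery {F : Type*} [Field F] [DecidableEq F] {N K : ℕ} {S C T S' C' T' : Type*}
    [Fintype S] [Fintype T] [Fintype S'] [Fintype T']
    (P : Prefetching F N K S C) (P' : Prefetching F N K S' C') (d : Fin K → Fin N) (δ : ℕ)
    (L : Matrix (Fin N × S) T F) (L' : Matrix (Fin N × S') T' F) : Prop :=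
  ∀ k : Fin K, ∃ D : (C → F) → (C' → F) → (T → F) → (T' → F) → (S → F) × (S' → F),
    ∀ (x : Fin N × S → F) (x' : Fin N × S' → F) (e : T → F) (e' : T' → F),
      hammingNorm e + hammingNorm e' ≤ δ →
        D (P k *ᵥ x) (P' k *ᵥ x') (x ᵥ* L + e) (x' ᵥ* L' + e') =
          (fun s => x (d k, s), fun s => x' (d k, s))

/-- The rates of linear `δ`-error-correcting deliveries when the first part is the fraction `1 - θ`
of every file and the second part is the fraction `θ`. A packet of the first part is then the
fraction `(1 - θ) / |S|` of a file, and a packet of the second part is the fraction `θ / |S'|`. -/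
def sharedDeliveryRates {F : Type*} [Field F] [DecidableEq F] {N K : ℕ} {S C S' C' : Type*}
    [Fintype S] [Fintype S']
    (P : Prefetching F N K S C) (P' : Prefetching F N K S' C') (θ : ℝ)
    (d : Fin K → Fin N) (δ : ℕ) : Set ℝ :=
  {r : ℝ | ∃ (l l' : ℕ) (L : Matrix (Fin N × S) (Fin l) F) (L' : Matrix (Fin N × S') (Fin l') F),
    IsSharedDelivery P P' d δ L L' ∧
      r = (1 - θ) * ((l : ℝ) / (Fintype.card S : ℝ)) + θ * ((l' : ℝ) / (Fintype.card S' : ℝ))}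

/-- The expected minimum rate of memory sharing, under a uniformly random demand. -/
noncomputable def sharedAvgRate {F : Type*} [Field F] [DecidableEq F] {N K : ℕ}
    {S C S' C' : Type*} [Fintype S] [Fintype S']
    (P : Prefetching F N K S C) (P' : Prefetching F N K S' C') (θ : ℝ) (δ : ℕ) : ℝ :=
  𝔼 d : Fin K → Fin N, sInf (sharedDeliveryRates P P' θ d δ)

/-- The number of coded packets in the cache of a user: `1` if `N = K`, and `N` if `N < K`. -/
def cflBlock (N K : ℕ) : ℕ := if N = K then 1 else N

/-- The subfiles of a file: the pair `(i, j)` stands for the subfile number `b (i - 1) + j`, with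
`b = cflBlock N K`, which is the `j`-th of the subfiles that belong to user `i`. -/
abbrev CFLSub (N K : ℕ) : Type := Fin K × Fin (cflBlock N K)

/-- The number `n_CFL` of subfiles of a file: `N` if `N = K`, and `N K` if `N < K`. -/
def nCFL (N K : ℕ) : ℕ := if N = K then N else N * K

/-- The number of subfiles is what it should be. -/
theorem card_CFLSub (N K : ℕ) : Fintype.card (CFLSub N K) = nCFL N K := by
  unfold nCFL
  by_cases h : N = K
  · simp [CFLSub, cflBlock, h]
  · simp [CFLSub, cflBlock, h, mul_comm]

/-- The CFL prefetching scheme: user `k` caches, for each of its own subfile positions `(k, j)`, the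
sum over all files of the subfiles at that position. -/
def cflPrefetching (F : Type*) [Field F] (N K : ℕ) :
    Prefetching F N K (CFLSub N K) (Fin (cflBlock N K)) :=
  fun k j m => if m.2 = (k, j) then 1 else 0

/-- The prefetching scheme for `M = 0`: nothing is cached; a file is divided into `s` subfiles. -/
def noPrefetching (F : Type*) (N K s : ℕ) : Prefetching F N K (Fin s) (Fin 0) :=
  fun _ j => j.elim0

/-- The average rate at cache size `M ∈ [0, 1/K]`, in units of one file: the fraction `K M` of every
file is cached by the CFL scheme, which takes up `K M * (1/K) = M` of the cache of each user, and the
other part of every file, divided into `s` subfiles, is not cached. -/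
noncomputable def cflAvgRate (F : Type*) [Field F] [DecidableEq F] (N K s δ : ℕ) (M : ℝ) : ℝ :=
  sharedAvgRate (noPrefetching F N K s) (cflPrefetching F N K) (K * M) δ

/-- The number `N_e(d)` of distinct demands. -/
def numDistinct {N K : ℕ} (d : Fin K → Fin N) : ℕ := (Finset.univ.image d).card

/-- The first user whose demand is that of user `k`. -/
def leader {N K : ℕ} (d : Fin K → Fin N) (k : Fin K) : Fin K :=
  (Finset.univ.filter (fun i => d i = d k)).min' ⟨k, by simp⟩

/-- The indices of the transmissions of the CFL delivery. If not all the files are demanded, these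
are all the subfiles of the demanded files. If all the files are demanded, they are all
`(n, i, j)` but those for which `n` is demanded by `i` and `i` is the first user demanding it. -/
def cflTransmissions {N K : ℕ} (d : Fin K → Fin N) : Finset (Fin N × CFLSub N K) :=
  if numDistinct d = N then
    Finset.univ.filter (fun t => ¬ (t.1 = d t.2.1 ∧ leader d t.2.1 = t.2.1))
  else Finset.univ.filter (fun t => t.1 ∈ Finset.univ.image d)

/-- The CFL delivery. The transmission with index `(n, i, j)` is the subfile `X_{n,(i,j)}`, except
that it is `X_{n,(i,j)} + X_{n,(i',j)}`, with `i'` the first user demanding `n`, if all the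
files are demanded and `n` is the demand of user `i`. -/
def cflDelivery (F : Type*) [Field F] {N K : ℕ} (d : Fin K → Fin N) :
    Matrix (Fin N × CFLSub N K) (cflTransmissions d) F :=
  fun m t => (if m = t.1 then 1 else 0) +
    (if numDistinct d = N ∧ t.1.1 = d t.1.2.1 ∧ m = (t.1.1, leader d t.1.2.1, t.1.2.2)
      then 1 else 0)

/-- The lower convex envelope of a set of points of the plane, as a function of the abscissa. -/
noncomputable def lowerConvexEnvelope (A : Set (ℝ × ℝ)) (x : ℝ) : ℝ :=
  sInf {y : ℝ | (x, y) ∈ convexHull ℝ A}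

/-!
Call a vector `x` of subfiles critical for a demand if some user with cache content `0` requests a
file that is nonzero in `x`. By linearity a delivery `L` corrects `δ` errors exactly if `x ᵥ* L` has
weight at least `2δ + 1` for every critical `x` (`isDelivery_iff`). Two consequences sandwich the
optimal length.

* If all nonzero vectors of a subspace `U` are critical, then `L` maps `U` injectively onto a code of
  minimum distance at least `2δ + 1`, so `L` has at least `N_q[dim U, 2δ + 1]` columns
  (`IsDelivery.shortestLength_finrank_le`). The matrices `A + R` are injective on `U` as well, so
  `dim U ≤ κ` (`finrank_le_minRank`).
* An error-free delivery of length `ℓ` gives `κ ≤ ℓ` (`IsDelivery.minRank_le_card`), and followed by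
  a code of dimension `ℓ` and minimum distance `2δ + 1` it corrects `δ` errors
  (`IsDelivery.mul_isGeneratorMatrix`).

For the CFL scheme both bounds meet: the CFL delivery is decodable (`cflDelivery_isDelivery_zero`),
and there is a space of critical vectors whose dimension is the number of its transmissions
(`exists_criticalVectors_submodule`). Hence this number is `κ`, and the minimum rate follows.

For memory sharing, a shared delivery corrects `δ` errors if and only if its two parts do
(`isSharedDelivery_iff`), so the minimum rate is affine in the memory, which is what the lower convex
envelope of two points amounts to (`lowerConvexEnvelope_pair`).
-/

/-! ### Linear codes -/

section Codes

variable {F : Type*} [Field F] [DecidableEq F]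

/-- Zeroing coordinates in the support of a codeword of least weight lowers the minimum distance
to any prescribed positive value without changing the length or the dimension. -/
theorem exists_hasMinDist_of_le {n D : ℕ} (hD : 1 ≤ D) (C : Submodule F (Fin n → F))
    (hC : ∀ c ∈ C, c ≠ 0 → D ≤ hammingNorm c) :
    ∃ C' : Submodule F (Fin n → F), Module.finrank F C' = Module.finrank F C ∧
      HasMinDist C' D := by
  by_cases h0 : C = ⊥
  · exact ⟨C, rfl, Or.inl h0⟩
  obtain ⟨c₁, hc₁, hc₁0⟩ := C.ne_bot_iff.mp h0
  have hne : {w : ℕ | ∃ c ∈ C, c ≠ 0 ∧ hammingNorm c = w}.Nonempty := ⟨_, c₁, hc₁, hc₁0, rfl⟩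
  obtain ⟨c, hc, hc0, hcw⟩ := Nat.sInf_mem hne
  have hmin : ∀ y ∈ C, y ≠ 0 → hammingNorm c ≤ hammingNorm y := fun y hy hy0 => by
    rw [hcw]
    exact Nat.sInf_le ⟨y, hy, hy0, rfl⟩
  obtain ⟨A, hAsub, hAcard⟩ := Finset.exists_subset_card_eq
    (s := Finset.univ.filter (fun i => c i ≠ 0)) (n := hammingNorm c - D) (Nat.sub_le _ _)
  let π : (Fin n → F) →ₗ[F] (Fin n → F) :=
    LinearMap.pi fun i => if i ∈ A then 0 else LinearMap.proj i
  have hπ : ∀ y i, π y i = if i ∈ A then 0 else y i := fun y i => by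
    simp only [π, LinearMap.pi_apply]; split_ifs <;> simp
  have hπsupp : ∀ y, Finset.univ.filter (fun i => π y i ≠ 0) =
      Finset.univ.filter (fun i => y i ≠ 0) \ A := fun y => by
    ext i
    simp only [hπ, Finset.mem_filter, Finset.mem_univ, true_and, Finset.mem_sdiff]
    split_ifs with h <;> simp [h]
  have hcD := hC c hc hc0
  have hle : ∀ y ∈ C, y ≠ 0 → D ≤ hammingNorm (π y) := fun y hy hy0 => by
    have h1 := hmin y hy hy0
    have h2 := Finset.le_card_sdiff A (Finset.univ.filter (fun i => y i ≠ 0))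
    rw [← hπsupp] at h2
    simp only [hammingNorm] at *
    omega
  have hinj : Function.Injective (π.domRestrict C) := by
    refine (injective_iff_map_eq_zero _).mpr fun y hy => ?_
    by_contra hy0
    have := hle y y.2 (fun h => hy0 (Subtype.ext h))
    rw [LinearMap.domRestrict_apply] at hy
    rw [hy, hammingNorm_zero] at this
    omega
  refine ⟨LinearMap.range (π.domRestrict C), LinearMap.finrank_range_of_inj hinj, Or.inr ⟨?_, ?_⟩⟩
  · have hw : hammingNorm (π c) = D := by
      have h2 := Finset.card_sdiff_of_subset hAsub
      rw [← hπsupp] at h2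
      simp only [hammingNorm] at *
      omega
    exact ⟨π c, ⟨⟨c, hc⟩, rfl⟩, hammingNorm_ne_zero_iff.mp (by omega), hw⟩
  · rintro w ⟨_, ⟨y, rfl⟩, hy0, rfl⟩
    exact hle y y.2 fun h => hy0 (by rw [LinearMap.domRestrict_apply, h, map_zero])

theorem shortestLength_finrank_le {n D : ℕ} (hD : 1 ≤ D) (C : Submodule F (Fin n → F))
    (hC : ∀ c ∈ C, c ≠ 0 → D ≤ hammingNorm c) :
    shortestLength F (Module.finrank F C) D ≤ n :=
  Nat.sInf_le (exists_hasMinDist_of_le hD C hC)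

/-- The `D`-fold repetition of `F ^ k` has dimension `k` and minimum distance at least `D`. -/
theorem exists_code_finrank_eq (k D : ℕ) :
    ∃ (n : ℕ) (C : Submodule F (Fin n → F)), Module.finrank F C = k ∧
      ∀ c ∈ C, c ≠ 0 → D ≤ hammingNorm c := by
  by_cases hD : D = 0
  · exact ⟨k, ⊤, by simp, by simp [hD]⟩
  let φ : (Fin k → F) →ₗ[F] (Fin (k * D) → F) :=
    LinearMap.funLeft F F fun i => (finProdFinEquiv.symm i).1
  have hinj : Function.Injective φ := by
    refine LinearMap.funLeft_injective_of_surjective _ _ _ fun i => ?_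
    exact ⟨finProdFinEquiv (i, ⟨0, Nat.pos_of_ne_zero hD⟩), by simp⟩
  refine ⟨k * D, LinearMap.range φ, by simp [LinearMap.finrank_range_of_inj hinj], ?_⟩
  rintro _ ⟨y, rfl⟩ hy
  obtain ⟨i, hi⟩ : ∃ i, y i ≠ 0 := by
    by_contra! h
    exact hy (by rw [show y = 0 from funext h, map_zero])
  calc D = (Finset.univ.map ⟨fun j : Fin D => finProdFinEquiv (i, j),
        fun a b h => by simpa using h⟩).card := by simp
    _ ≤ hammingNorm (φ y) := Finset.card_le_card fun t ht => by
        simp only [Finset.mem_map, Finset.mem_univ, true_and] at ht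
        obtain ⟨j, rfl⟩ := ht
        refine Finset.mem_filter.mpr ⟨Finset.mem_univ _, ?_⟩
        change y (finProdFinEquiv.symm (finProdFinEquiv (i, j))).1 ≠ 0
        rwa [Equiv.symm_apply_apply]

/-- An optimal code exists, with a generator matrix whose rows carry any index type of the right
cardinality. -/
theorem exists_isGeneratorMatrix_shortestLength {T : Type*} [Fintype T] {D : ℕ} (hD : 1 ≤ D) :
    ∃ G : Matrix T (Fin (shortestLength F (Fintype.card T) D)) F, IsGeneratorMatrix G D := by
  have hne : {n : ℕ | ∃ C : Submodule F (Fin n → F),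
      Module.finrank F C = Fintype.card T ∧ HasMinDist C D}.Nonempty := by
    obtain ⟨n, C, hk, hC⟩ := exists_code_finrank_eq (F := F) (Fintype.card T) D
    obtain ⟨C', hC', hd⟩ := exists_hasMinDist_of_le hD C hC
    exact ⟨n, C', hC'.trans hk, hd⟩
  obtain ⟨C, hk, hd⟩ := Nat.sInf_mem hne
  let b := (Module.finBasisOfFinrankEq F C hk).reindex (Fintype.equivFin T).symm
  have hspan : Submodule.span F (Set.range (C.subtype ∘ b)) = C := by
    rw [Set.range_comp, Submodule.span_image, b.span_eq, Submodule.map_subtype_top]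
  refine ⟨Matrix.of (C.subtype ∘ b), b.linearIndependent.map' C.subtype C.ker_subtype, ?_⟩
  change HasMinDist (Submodule.span F (Set.range (C.subtype ∘ b))) D
  rw [hspan]
  exact hd

theorem IsGeneratorMatrix.le_hammingNorm_vecMul {T : Type*} [Fintype T] {n D : ℕ}
    {G : Matrix T (Fin n) F} (hG : IsGeneratorMatrix G D) {y : T → F} (hy : y ≠ 0) :
    D ≤ hammingNorm (y ᵥ* G) := by
  have hne : y ᵥ* G ≠ 0 := fun h =>
    hy (Matrix.vecMul_injective_iff.mpr hG.1 (h.trans (Matrix.zero_vecMul G).symm))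
  have hmem : y ᵥ* G ∈ Submodule.span F (Set.range G.row) := by
    rw [← range_vecMulLinear]
    exact ⟨y, rfl⟩
  rcases hG.2 with h | h
  · exact absurd ((Submodule.mem_bot F).mp (h ▸ hmem)) hne
  · exact h.2 ⟨_, hmem, hne, rfl⟩

end Codes

/-! ### Critical vectors and error-correcting deliveries -/

section Delivery

variable {F : Type*} [Field F] {N K : ℕ} {S C : Type*} [Fintype S]

/-- The critical vectors of a demand: the contents `x` of the server that some user cannot tell
from `0` by its cache, although the file it requests is not `0`. -/
def criticalVectors (P : Prefetching F N K S C) (d : Fin K → Fin N) : Set (Fin N × S → F) :=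
  {x | ∃ k, P k *ᵥ x = 0 ∧ ∃ s, x (d k, s) ≠ 0}

/-- A vector of weight at most `2δ` is a difference of two vectors of weight at most `δ`. -/
theorem exists_eq_sub_of_hammingNorm_le [DecidableEq F] {T : Type*} [Fintype T] {δ : ℕ} (y : T → F)
    (hy : hammingNorm y ≤ 2 * δ) :
    ∃ a b : T → F, hammingNorm a ≤ δ ∧ hammingNorm b ≤ δ ∧ y = a - b := by
  classical
  obtain ⟨A, hAsub, hAcard⟩ := Finset.exists_subset_card_eq
    (s := Finset.univ.filter (fun i => y i ≠ 0)) (n := min δ (hammingNorm y)) (min_le_right _ _)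
  refine ⟨fun i => if i ∈ A then y i else 0, fun i => if i ∈ A then 0 else -y i, ?_, ?_, ?_⟩
  · refine (Finset.card_le_card (t := A) fun i hi => ?_).trans (hAcard.trans_le (min_le_left _ _))
    by_contra h
    simp [h] at hi
  · refine (Finset.card_le_card (t := Finset.univ.filter (fun i => y i ≠ 0) \ A)
      fun i hi => ?_).trans ?_
    · by_cases h : i ∈ A <;> simp_all
    · rw [Finset.card_sdiff_of_subset hAsub, hAcard]
      simp only [hammingNorm] at *
      omega
  · ext i
    by_cases h : i ∈ A <;> simp [h]

/-- Unique decoding: a delivery corrects `δ` errors if and only if it maps every critical vector to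
a word of weight at least `2δ + 1`. -/
theorem isDelivery_iff [DecidableEq F] {T : Type*} [Fintype T] {P : Prefetching F N K S C}
    {d : Fin K → Fin N} {δ : ℕ} {L : Matrix (Fin N × S) T F} :
    IsDelivery P d δ L ↔ ∀ x ∈ criticalVectors P d, 2 * δ + 1 ≤ hammingNorm (x ᵥ* L) := by
  classical
  constructor
  · rintro h x ⟨k, hk, s, hs⟩
    by_contra! hlt
    obtain ⟨a, b, ha, hb, hab⟩ := exists_eq_sub_of_hammingNorm_le (x ᵥ* L) (Nat.lt_succ_iff.mp hlt)
    obtain ⟨D, hD⟩ := h k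
    have h1 := hD x b hb
    have h2 := hD 0 a ha
    rw [hab, sub_add_cancel, hk] at h1
    rw [Matrix.mulVec_zero, Matrix.zero_vecMul, zero_add, h1] at h2
    exact hs (congrFun h2 s)
  · intro h k
    refine ⟨fun c y => if hx : ∃ x : Fin N × S → F, P k *ᵥ x = c ∧
      ∃ e : T → F, hammingNorm e ≤ δ ∧ x ᵥ* L + e = y then fun s => hx.choose (d k, s) else 0, ?_⟩
    intro x e he
    have hx : ∃ x' : Fin N × S → F, P k *ᵥ x' = P k *ᵥ x ∧
      ∃ e' : T → F, hammingNorm e' ≤ δ ∧ x' ᵥ* L + e' = x ᵥ* L + e := ⟨x, rfl, e, he, rfl⟩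
    refine (dif_pos hx).trans ?_
    obtain ⟨hc, e', he', hy⟩ := hx.choose_spec
    generalize hx.choose = x' at *
    funext s
    by_contra hs
    have hcrit := h (x' - x) ⟨k, by rw [Matrix.mulVec_sub, hc, sub_self], s, sub_ne_zero.mpr hs⟩
    have heq : (x' - x) ᵥ* L = e - e' := by
      rw [Matrix.sub_vecMul, sub_eq_sub_iff_add_eq_add, hy, add_comm]
    have hle : hammingNorm (e - e') ≤ hammingNorm e' + hammingNorm e := by
      have := hammingDist_triangle e' 0 e
      rwa [hammingDist_eq_hammingNorm, neg_add_eq_sub, hammingDist_zero_right, hammingDist_zero_left] at this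
    rw [heq] at hcrit
    omega

theorem isDelivery_zero_iff [DecidableEq F] {T : Type*} [Fintype T] {P : Prefetching F N K S C}
    {d : Fin K → Fin N} {L : Matrix (Fin N × S) T F} :
    IsDelivery P d 0 L ↔ ∀ x ∈ criticalVectors P d, x ᵥ* L ≠ 0 := by
  rw [isDelivery_iff]
  refine forall₂_congr fun x _ => ?_
  rw [← hammingNorm_ne_zero_iff]
  omega

/-- An error-free delivery followed by a code of minimum distance `2δ + 1` corrects `δ` errors. -/
theorem IsDelivery.mul_isGeneratorMatrix [DecidableEq F] {T : Type*} [Fintype T]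
    {P : Prefetching F N K S C} {d : Fin K → Fin N} {L : Matrix (Fin N × S) T F}
    (hL : IsDelivery P d 0 L) {n δ : ℕ} {G : Matrix T (Fin n) F}
    (hG : IsGeneratorMatrix G (2 * δ + 1)) : IsDelivery P d δ (L * G) := by
  rw [isDelivery_iff]
  intro x hx
  rw [← Matrix.vecMul_vecMul]
  exact hG.le_hammingNorm_vecMul (isDelivery_zero_iff.mp hL x hx)

theorem deliveryRates_nonempty [DecidableEq F] (P : Prefetching F N K S C)
    (d : Fin K → Fin N) (δ : ℕ) : (deliveryRates P d δ).Nonempty := by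
  classical
  have h0 : IsDelivery P d 0 (1 : Matrix (Fin N × S) (Fin N × S) F) := by
    rw [isDelivery_zero_iff]
    rintro x ⟨k, -, s, hs⟩ h
    rw [Matrix.vecMul_one] at h
    exact hs (congrFun h _)
  obtain ⟨G, hG⟩ := exists_isGeneratorMatrix_shortestLength (F := F) (T := Fin N × S)
    (D := 2 * δ + 1) (by omega)
  exact ⟨_, _, _, h0.mul_isGeneratorMatrix hG, rfl⟩

theorem bddBelow_deliveryRates [DecidableEq F] (P : Prefetching F N K S C)
    (d : Fin K → Fin N) (δ : ℕ) : BddBelow (deliveryRates P d δ) := by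
  refine ⟨0, ?_⟩
  rintro _ ⟨l, L, -, rfl⟩
  positivity

/-- The image under a delivery of a space of critical vectors is a code, whose length is at least
that of an optimal one. -/
theorem IsDelivery.shortestLength_finrank_le [DecidableEq F] {P : Prefetching F N K S C}
    {d : Fin K → Fin N} {δ l : ℕ} {L : Matrix (Fin N × S) (Fin l) F} (hL : IsDelivery P d δ L)
    (U : Submodule F (Fin N × S → F)) (hU : ∀ x ∈ U, x ≠ 0 → x ∈ criticalVectors P d) :
    shortestLength F (Module.finrank F U) (2 * δ + 1) ≤ l := by
  rw [isDelivery_iff] at hL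
  let φ : U →ₗ[F] (Fin l → F) := L.vecMulLinear.domRestrict U
  have hφ : ∀ x : U, x ≠ 0 → 2 * δ + 1 ≤ hammingNorm (φ x) := fun x hx =>
    hL x (hU x x.2 fun h => hx (Subtype.ext h))
  have hinj : Function.Injective φ := by
    refine (injective_iff_map_eq_zero φ).mpr fun x hx => ?_
    by_contra h0
    have := hφ x h0
    rw [hx, hammingNorm_zero] at this
    omega
  rw [← LinearMap.finrank_range_of_inj hinj]
  refine _root_.shortestLength_finrank_le (by omega) _ ?_
  rintro _ ⟨x, rfl⟩ hx
  exact hφ x fun h => hx (by rw [h, map_zero])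

end Delivery

/-! ### Bounds for the min-rank -/

section MinRank

variable {F : Type*} [Field F] {N K : ℕ} {S C : Type*} [Fintype S] [DecidableEq S]

/-- The matrices `A + R` of the min-rank problem are injective on spaces of critical vectors. -/
theorem finrank_le_minRank {P : Prefetching F N K S C} {d : Fin K → Fin N}
    (U : Submodule F (Fin N × S → F)) (hU : ∀ x ∈ U, x ≠ 0 → x ∈ criticalVectors P d) :
    Module.finrank F U ≤ (inducedGIC P d).minRank := by
  refine le_csInf ⟨_, 0, fun i => Submodule.zero_mem _, rfl⟩ ?_
  rintro _ ⟨A, hA, rfl⟩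
  have hinj : Function.Injective ((A + (inducedGIC P d).request).mulVecLin.domRestrict U) := by
    refine (injective_iff_map_eq_zero _).mpr fun x hx => ?_
    by_contra h0
    obtain ⟨k, hk, s, hs⟩ := hU x x.2 fun h => h0 (Subtype.ext h)
    refine hs ?_
    have hrow : A.row (k, s) ⬝ᵥ (x : Fin N × S → F) = 0 := by
      have hmem : A.row (k, s) ∈ Submodule.span F (Set.range (P k).row) := hA (k, s)
      generalize A.row (k, s) = a at hmem
      induction hmem using Submodule.span_induction with
      | mem y hy => obtain ⟨c, rfl⟩ := hy; exact congrFun hk c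
      | zero => exact zero_dotProduct _
      | add y z _ _ hy hz => rw [add_dotProduct, hy, hz, add_zero]
      | smul a y _ hy => rw [smul_dotProduct, hy, smul_zero]
    have h := congrFun hx (k, s)
    rw [LinearMap.domRestrict_apply, Matrix.mulVecLin_apply, Matrix.add_mulVec, Pi.add_apply] at h
    have hreq : ((inducedGIC P d).request *ᵥ (x : Fin N × S → F)) (k, s) = x.1 (d k, s) :=
      single_one_dotProduct _ _
    have hrow' : (A *ᵥ (x : Fin N × S → F)) (k, s) = 0 := hrow
    rw [hreq, hrow', zero_add] at h
    exact h
  calc Module.finrank F U = Module.finrank F (LinearMap.range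
        ((A + (inducedGIC P d).request).mulVecLin.domRestrict U)) :=
        (LinearMap.finrank_range_of_inj hinj).symm
    _ ≤ (A + (inducedGIC P d).request).rank :=
        Submodule.finrank_mono (LinearMap.range_domRestrict_le_range _ _)

theorem mem_span_range_of_dotProduct {ι κ : Type*} [Fintype ι] [Finite κ] (v : κ → ι → F)
    (w : ι → F) (h : ∀ x, (∀ i, v i ⬝ᵥ x = 0) → w ⬝ᵥ x = 0) :
    w ∈ Submodule.span F (Set.range v) := by
  classical
  have hmem : dotProductEquiv F ι w ∈
      Submodule.span F (Set.range fun i => dotProductEquiv F ι (v i)) := by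
    refine mem_span_of_iInf_ker_le_ker fun x hx => ?_
    simp only [Submodule.mem_iInf, LinearMap.mem_ker] at hx
    exact h x hx
  rw [show (Set.range fun i => dotProductEquiv F ι (v i)) =
    (dotProductEquiv F ι).toLinearMap '' Set.range v from
    Set.range_comp (dotProductEquiv F ι) v, Submodule.span_image] at hmem
  obtain ⟨u, hu, huw⟩ := hmem
  rwa [← (dotProductEquiv F ι).injective huw]

/-- In an error-free delivery every requested packet is a combination of cached and transmitted
packets, so that modulo the cached ones all requests lie in the span of the transmitted ones. -/
theorem IsDelivery.minRank_le_card [DecidableEq F] [Finite C] {T : Type*} [Fintype T]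
    {P : Prefetching F N K S C} {d : Fin K → Fin N} {L : Matrix (Fin N × S) T F}
    (hL : IsDelivery P d 0 L) : (inducedGIC P d).minRank ≤ Fintype.card T := by
  classical
  rw [isDelivery_zero_iff] at hL
  have hspan : ∀ r : Fin K × S, ∃ a ∈ Submodule.span F (Set.range (P r.1).row),
      a + Pi.single (d r.1, r.2) 1 ∈ Submodule.span F (Set.range Lᵀ.row) := by
    rintro ⟨k, s⟩
    have hmem := mem_span_range_of_dotProduct (Sum.elim (P k).row Lᵀ.row)
      (Pi.single (d k, s) 1) fun x hx => by
        by_contra hs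
        rw [single_one_dotProduct] at hs
        refine hL x ⟨k, funext fun c => hx (Sum.inl c), s, hs⟩ (funext fun t => ?_)
        rw [← Matrix.mulVec_transpose]
        exact hx (Sum.inr t)
    rw [Set.Sum.elim_range, Submodule.span_union] at hmem
    obtain ⟨y, hy, z, hz, hyz⟩ := Submodule.mem_sup.mp hmem
    refine ⟨-y, Submodule.neg_mem _ hy, ?_⟩
    rwa [← hyz, neg_add_cancel_left]
  choose A hA hAL using hspan
  have hle : (inducedGIC P d).minRank ≤ (Matrix.of A + (inducedGIC P d).request).rank :=
    Nat.sInf_le ⟨Matrix.of A, hA, rfl⟩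
  refine hle.trans ?_
  rw [Matrix.rank_eq_finrank_span_row]
  calc _ ≤ Module.finrank F (Submodule.span F (Set.range Lᵀ.row)) := by
        refine Submodule.finrank_mono (Submodule.span_le.mpr ?_)
        rintro _ ⟨r, rfl⟩
        exact hAL r
    _ ≤ Fintype.card T := finrank_range_le_card _

end MinRank

/-! ### The CFL scheme -/

section CFL

variable {F : Type*} [Field F] {N K : ℕ}

theorem cflPrefetching_mulVec (k : Fin K) (x : Fin N × CFLSub N K → F)
    (j : Fin (cflBlock N K)) :
    (cflPrefetching F N K k *ᵥ x) j = ∑ n, x (n, k, j) := by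
  simp only [Matrix.mulVec, dotProduct, cflPrefetching, ite_mul, one_mul, zero_mul,
    Fintype.sum_prod_type, Finset.sum_ite_eq', Finset.mem_univ, if_true]

theorem numDistinct_eq_iff {d : Fin K → Fin N} :
    numDistinct d = N ↔ Function.Surjective d := by
  have h := Finset.card_eq_iff_eq_univ (Finset.univ.image d)
  rw [Fintype.card_fin] at h
  rw [numDistinct, h, Finset.eq_univ_iff_forall]
  simp [Function.Surjective]

theorem apply_leader (d : Fin K → Fin N) (k : Fin K) : d (leader d k) = d k :=
  (Finset.mem_filter.mp (Finset.min'_mem (Finset.univ.filter fun i => d i = d k) _)).2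

theorem leader_congr {d : Fin K → Fin N} {i k : Fin K} (h : d i = d k) :
    leader d i = leader d k := by
  simp only [leader, h]

theorem leader_leader (d : Fin K → Fin N) (k : Fin K) : leader d (leader d k) = leader d k :=
  leader_congr (apply_leader d k)

theorem mem_cflTransmissions {d : Fin K → Fin N} {t : Fin N × CFLSub N K} :
    t ∈ cflTransmissions d ↔ if Function.Surjective d
      then ¬ (t.1 = d t.2.1 ∧ leader d t.2.1 = t.2.1) else ∃ i, d i = t.1 := by
  rw [cflTransmissions]
  simp only [numDistinct_eq_iff]
  split_ifs <;> simp

theorem vecMul_cflDelivery {d : Fin K → Fin N} (x : Fin N × CFLSub N K → F)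
    (t : cflTransmissions d) :
    (x ᵥ* cflDelivery F d) t = x t + if Function.Surjective d ∧ t.1.1 = d t.1.2.1
      then x (t.1.1, leader d t.1.2.1, t.1.2.2) else 0 := by
  simp only [Matrix.vecMul, dotProduct, cflDelivery, numDistinct_eq_iff, mul_add,
    Finset.sum_add_distrib, mul_ite, mul_one, mul_zero, Finset.sum_ite_eq', Finset.mem_univ,
    if_true]
  congr 1
  split_ifs with h
  · simp [h.1, h.2]
  · refine Finset.sum_eq_zero fun m _ => if_neg fun h' => h ⟨h'.1, h'.2.1⟩

/-- If all files are demanded, then a user finds the subfile of the leader for its file either in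
its own cache, when it is the leader, or in its cache and the sum sent for its own position. -/
theorem cflDelivery_isDelivery_zero [DecidableEq F] (d : Fin K → Fin N) :
    IsDelivery (cflPrefetching F N K) d 0 (cflDelivery F d) := by
  rw [isDelivery_zero_iff]
  rintro x ⟨k, hk, ⟨i, j⟩, hs⟩ hx
  have htr : ∀ t ∈ cflTransmissions d, (x t + if Function.Surjective d ∧ t.1 = d t.2.1
      then x (t.1, leader d t.2.1, t.2.2) else 0) = 0 := fun t ht => by
    rw [← vecMul_cflDelivery x ⟨t, ht⟩, hx, Pi.zero_apply]
  by_cases hd : Function.Surjective d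
  swap
  · have := htr (d k, i, j) (by rw [mem_cflTransmissions, if_neg hd]; exact ⟨k, rfl⟩)
    rw [if_neg fun h => hd h.1, add_zero] at this
    exact hs this
  have hplain : ∀ n i, n ≠ d i → x (n, i, j) = 0 := fun n i hn => by
    have := htr (n, i, j) (by rw [mem_cflTransmissions, if_pos hd]; exact fun h => hn h.1)
    rwa [if_neg fun h => hn h.2, add_zero] at this
  have hsum : ∀ i, leader d i ≠ i → x (d i, i, j) + x (d i, leader d i, j) = 0 := fun i hi => by
    have := htr (d i, i, j) (by rw [mem_cflTransmissions, if_pos hd]; exact fun h => hi h.2)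
    rwa [if_pos ⟨hd, rfl⟩] at this
  -- the cache of `k` reveals the requested subfile at the position of `k` itself
  have hown : x (d k, k, j) = 0 := by
    have h := congrFun hk j
    rwa [cflPrefetching_mulVec, Fintype.sum_eq_single (d k) fun n hn => hplain n k hn] at h
  have hlead : x (d k, leader d k, j) = 0 := by
    by_cases h : leader d k = k
    · rwa [h]
    · simpa [hown] using hsum k h
  refine hs ?_
  by_cases hik : d i = d k
  · rw [← leader_congr hik, ← hik] at hlead
    by_cases h : leader d i = i
    · rwa [h, hik] at hlead
    · have := hsum i h
      rwa [hlead, add_zero, hik] at this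
  · exact hplain _ _ (Ne.symm hik)

/-- A space of critical vectors whose codimension is the number of subfiles that the CFL delivery
does not address. If all files are demanded, it consists of the vectors on which the caches of all
leaders vanish: a nonzero file is then requested by a leader with zero cache. Otherwise one
undemanded file serves to make all caches vanish, and the other undemanded files are `0`. -/
theorem exists_criticalVectors_submodule (d : Fin K → Fin N) :
    ∃ U : Submodule F (Fin N × CFLSub N K → F), (cflTransmissions d).card ≤ Module.finrank F U ∧
      ∀ x ∈ U, x ≠ 0 → x ∈ criticalVectors (cflPrefetching F N K) d := by
  -- it suffices to give one functional for each index outside of the transmissions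
  suffices h : ∃ φ : Fin N × CFLSub N K → (Fin N × CFLSub N K → F) →ₗ[F] F,
      ∀ x, (∀ t ∉ cflTransmissions d, φ t x = 0) → x ≠ 0 →
        x ∈ criticalVectors (cflPrefetching F N K) d by
    obtain ⟨φ, hφ⟩ := h
    let Φ := LinearMap.pi fun t : {t // t ∉ cflTransmissions d} => φ t
    refine ⟨LinearMap.ker Φ, ?_, fun x hx => hφ x fun t ht => congrFun hx ⟨t, ht⟩⟩
    have h1 := LinearMap.finrank_range_add_finrank_ker Φ
    have h2 := Submodule.finrank_le (LinearMap.range Φ)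
    have h3 := Fintype.card_subtype_compl (fun t => t ∈ cflTransmissions d)
    have h4 := Finset.card_le_univ (cflTransmissions d)
    simp only [Module.finrank_fintype_fun_eq_card] at h1 h2
    rw [Fintype.card_coe] at h3
    omega
  let σ : CFLSub N K → (Fin N × CFLSub N K → F) →ₗ[F] F := fun p =>
    ∑ n, LinearMap.proj (n, p)
  have hσ : ∀ p x, σ p x = ∑ n, x (n, p) := fun p x => by simp [σ]
  by_cases hd : Function.Surjective d
  · refine ⟨fun t => σ t.2, fun x hx hx0 => ?_⟩
    obtain ⟨⟨n, p⟩, hnp⟩ := Function.ne_iff.mp hx0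
    obtain ⟨k, rfl⟩ := hd n
    refine ⟨leader d k, funext fun j => ?_, p, by rwa [apply_leader d k]⟩
    rw [cflPrefetching_mulVec, ← hσ]
    refine hx (d (leader d k), leader d k, j) ?_
    rw [mem_cflTransmissions, if_pos hd, not_not]
    exact ⟨rfl, leader_leader d k⟩
  · obtain ⟨n₀, hn₀⟩ : ∃ n₀, ∀ i, d i ≠ n₀ := by
      simpa [Function.Surjective] using hd
    refine ⟨fun t => if t.1 = n₀ then σ t.2 else LinearMap.proj t, fun x hx hx0 => ?_⟩
    have hmem : ∀ t : Fin N × CFLSub N K, t ∉ cflTransmissions d ↔ ∀ i, d i ≠ t.1 := fun t => by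
      rw [mem_cflTransmissions, if_neg hd, not_exists]
    have hcache : ∀ p, ∑ n, x (n, p) = 0 := fun p => by
      have := hx (n₀, p) ((hmem _).mpr hn₀)
      simpa [hσ] using this
    have hother : ∀ n p, n ≠ n₀ → (∀ i, d i ≠ n) → x (n, p) = 0 := fun n p hn h => by
      have := hx (n, p) ((hmem _).mpr h)
      simpa [hn] using this
    obtain ⟨k, p, hk⟩ : ∃ k p, x (d k, p) ≠ 0 := by
      by_contra! h
      have hne : ∀ n p, n ≠ n₀ → x (n, p) = 0 := fun n p hn => by
        by_cases hnd : ∃ i, d i = n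
        · obtain ⟨i, rfl⟩ := hnd
          exact h i p
        · exact hother n p hn fun i hi => hnd ⟨i, hi⟩
      refine hx0 (funext fun ⟨n, p⟩ => ?_)
      by_cases hn : n = n₀
      · rw [hn, Pi.zero_apply, ← hcache p, Fintype.sum_eq_single n₀ fun n hn => hne n p hn]
      · exact hne n p hn
    exact ⟨k, funext fun j => by rw [cflPrefetching_mulVec, hcache, Pi.zero_apply], p, hk⟩

theorem card_cflTransmissions [DecidableEq F] (d : Fin K → Fin N) :
    (cflTransmissions d).card = (inducedGIC (cflPrefetching F N K) d).minRank := by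
  refine le_antisymm ?_ ?_
  · obtain ⟨U, hcard, hU⟩ := exists_criticalVectors_submodule (F := F) d
    exact hcard.trans (finrank_le_minRank U hU)
  · exact (cflDelivery_isDelivery_zero d).minRank_le_card.trans_eq (Fintype.card_coe _)

theorem shortestLength_minRank_le [DecidableEq F] {d : Fin K → Fin N} {δ l : ℕ}
    {L : Matrix (Fin N × CFLSub N K) (Fin l) F} (hL : IsDelivery (cflPrefetching F N K) d δ L) :
    shortestLength F (inducedGIC (cflPrefetching F N K) d).minRank (2 * δ + 1) ≤ l := by
  obtain ⟨U, hcard, hU⟩ := exists_criticalVectors_submodule (F := F) d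
  have h : Module.finrank F U = (inducedGIC (cflPrefetching F N K) d).minRank :=
    (finrank_le_minRank U hU).antisymm ((card_cflTransmissions d).symm.trans_le hcard)
  rw [← h]
  exact hL.shortestLength_finrank_le U hU

theorem isLeast_deliveryRates_cflPrefetching [DecidableEq F] (d : Fin K → Fin N) (δ : ℕ) :
    IsLeast (deliveryRates (cflPrefetching F N K) d δ)
      ((shortestLength F (inducedGIC (cflPrefetching F N K) d).minRank (2 * δ + 1) : ℝ)
        / (nCFL N K : ℝ)) := by
  constructor
  · obtain ⟨G, hG⟩ := exists_isGeneratorMatrix_shortestLength (F := F) (T := cflTransmissions d)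
      (D := 2 * δ + 1) (by omega)
    refine ⟨_, _, (cflDelivery_isDelivery_zero d).mul_isGeneratorMatrix hG, ?_⟩
    rw [card_CFLSub, Fintype.card_coe, card_cflTransmissions (F := F)]
  · rintro _ ⟨l, L, hL, rfl⟩
    rw [card_CFLSub]
    have := shortestLength_minRank_le hL
    gcongr

end CFL

/-! ### Memory sharing -/

section MemorySharing

variable {F : Type*} [Field F] [DecidableEq F] {N K : ℕ} {S C S' C' : Type*}
  [Fintype S] [Fintype S']

/-- The adversary may spend all errors on either part, so a shared delivery has to correct `δ`
errors in each of them; and this suffices. -/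
theorem isSharedDelivery_iff {T T' : Type*} [Fintype T] [Fintype T']
    {P : Prefetching F N K S C} {P' : Prefetching F N K S' C'} {d : Fin K → Fin N} {δ : ℕ}
    {L : Matrix (Fin N × S) T F} {L' : Matrix (Fin N × S') T' F} :
    IsSharedDelivery P P' d δ L L' ↔ IsDelivery P d δ L ∧ IsDelivery P' d δ L' := by
  constructor
  · intro h
    refine ⟨fun k => ?_, fun k => ?_⟩ <;> obtain ⟨D, hD⟩ := h k
    · refine ⟨fun c y => (D c 0 y 0).1, fun x e he => ?_⟩
      have := hD x 0 e 0 (by simpa using he)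
      simp only [Matrix.mulVec_zero, Matrix.zero_vecMul, add_zero] at this
      simp only [this]
    · refine ⟨fun c y => (D 0 c 0 y).2, fun x e he => ?_⟩
      have := hD 0 x 0 e (by simpa using he)
      simp only [Matrix.mulVec_zero, Matrix.zero_vecMul, add_zero] at this
      simp only [this]
  · rintro ⟨h, h'⟩ k
    obtain ⟨D, hD⟩ := h k
    obtain ⟨D', hD'⟩ := h' k
    refine ⟨fun c c' y y' => (D c y, D' c' y'), fun x x' e e' he => ?_⟩
    simp only [hD x e (by omega), hD' x' e' (by omega)]

open scoped Pointwise in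
theorem sInf_sharedDeliveryRates (P : Prefetching F N K S C) (P' : Prefetching F N K S' C')
    {θ : ℝ} (h0 : 0 ≤ θ) (h1 : θ ≤ 1) (d : Fin K → Fin N) (δ : ℕ) :
    sInf (sharedDeliveryRates P P' θ d δ) = (1 - θ) * minRate P d δ + θ * minRate P' d δ := by
  have hset : sharedDeliveryRates P P' θ d δ =
      (1 - θ) • deliveryRates P d δ + θ • deliveryRates P' d δ := by
    ext r
    simp only [sharedDeliveryRates, isSharedDelivery_iff, deliveryRates, Set.mem_add,
      Set.mem_smul_set, Set.mem_ofPred_eq, smul_eq_mul]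
    constructor
    · rintro ⟨l, l', L, L', ⟨hL, hL'⟩, rfl⟩
      exact ⟨_, ⟨_, ⟨l, L, hL, rfl⟩, rfl⟩, _, ⟨_, ⟨l', L', hL', rfl⟩, rfl⟩, rfl⟩
    · rintro ⟨_, ⟨_, ⟨l, L, hL, rfl⟩, rfl⟩, _, ⟨_, ⟨l', L', hL', rfl⟩, rfl⟩, rfl⟩
      exact ⟨l, l', L, L', ⟨hL, hL'⟩, rfl⟩
  rw [hset, csInf_add (deliveryRates_nonempty P d δ).smul_set
    ((bddBelow_deliveryRates P d δ).smul_of_nonneg (sub_nonneg.mpr h1))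
    (deliveryRates_nonempty P' d δ).smul_set ((bddBelow_deliveryRates P' d δ).smul_of_nonneg h0),
    Real.sInf_smul_of_nonneg (sub_nonneg.mpr h1), Real.sInf_smul_of_nonneg h0]
  rfl

theorem sharedAvgRate_eq (P : Prefetching F N K S C) (P' : Prefetching F N K S' C')
    {θ : ℝ} (h0 : 0 ≤ θ) (h1 : θ ≤ 1) (δ : ℕ) :
    sharedAvgRate P P' θ δ = (1 - θ) * avgRate P δ + θ * avgRate P' δ := by
  simp only [sharedAvgRate, avgRate, sInf_sharedDeliveryRates P P' h0 h1,
    Finset.expect_add_distrib, Finset.mul_expect]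

theorem cflAvgRate_eq {s δ : ℕ} {M : ℝ} (hK : 1 ≤ K) (hM : M ∈ Set.Icc (0 : ℝ) (1 / (K : ℝ))) :
    cflAvgRate F N K s δ M = (1 - K * M) * avgRate (noPrefetching F N K s) δ +
      K * M * avgRate (cflPrefetching F N K) δ := by
  have hK' : (0 : ℝ) < K := by exact_mod_cast hK
  refine sharedAvgRate_eq _ _ (mul_nonneg hK'.le hM.1) ?_ δ
  have := (le_div_iff₀' hK').mp hM.2
  exact this

end MemorySharing

/-- The convex hull of two points with distinct abscissas is a segment, which has exactly one point
above each abscissa between them. -/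
theorem lowerConvexEnvelope_pair {h a b x : ℝ} (hh : 0 < h) (hx : x ∈ Set.Icc 0 h) :
    lowerConvexEnvelope {((0 : ℝ), a), (h, b)} x = (1 - x / h) * a + x / h * b := by
  have hset : {y : ℝ | (x, y) ∈ convexHull ℝ {((0 : ℝ), a), (h, b)}} =
      {(1 - x / h) * a + x / h * b} := by
    ext y
    rw [Set.mem_ofPred_eq, convexHull_pair, segment_eq_image, Set.mem_image, Set.mem_singleton_iff]
    constructor
    · rintro ⟨θ, -, hθ⟩
      simp only [Prod.smul_mk, Prod.mk_add_mk, smul_eq_mul, Prod.mk.injEq, mul_zero,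
        zero_add] at hθ
      rw [← hθ.1, mul_div_cancel_right₀ _ hh.ne', ← hθ.2]
    · rintro rfl
      refine ⟨x / h, ⟨div_nonneg hx.1 hh.le, (div_le_one hh).mpr hx.2⟩, ?_⟩
      simp [div_mul_cancel₀ _ hh.ne']
  rw [lowerConvexEnvelope, hset, csInf_singleton]

theorem theorem3 (F : Type*) [Field F] [Fintype F] [DecidableEq F]
    (N K δ : ℕ) (hN : 1 ≤ N) (hNK : N ≤ K) :
    -- the average rate at `M = 1 / K`
    avgRate (cflPrefetching F N K) δ =
      𝔼 d : Fin K → Fin N,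
        (shortestLength F (inducedGIC (cflPrefetching F N K) d).minRank (2 * δ + 1) : ℝ)
          / (nCFL N K : ℝ) ∧
    -- for each demand the minimum rate is attained
    (∀ d : Fin K → Fin N, IsLeast (deliveryRates (cflPrefetching F N K) d δ)
      ((shortestLength F (inducedGIC (cflPrefetching F N K) d).minRank (2 * δ + 1) : ℝ)
        / (nCFL N K : ℝ))) ∧
    -- it is attained by the CFL delivery concatenated with an optimal classical code
    (∀ d : Fin K → Fin N, ∀ k : ℕ, k = (inducedGIC (cflPrefetching F N K) d).minRank →
      IsDelivery (cflPrefetching F N K) d 0 (cflDelivery F d) ∧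
      (cflTransmissions d).card = k ∧
      (∃ G : Matrix (cflTransmissions d) (Fin (shortestLength F k (2 * δ + 1))) F,
        IsGeneratorMatrix G (2 * δ + 1)) ∧
      (∀ G : Matrix (cflTransmissions d) (Fin (shortestLength F k (2 * δ + 1))) F,
        IsGeneratorMatrix G (2 * δ + 1) →
          IsDelivery (cflPrefetching F N K) d δ (cflDelivery F d * G))) ∧
    -- the average rate for `M ∈ [0, 1 / K]`
    (∀ s : ℕ, 1 ≤ s →
      cflAvgRate F N K s δ 0 = avgRate (noPrefetching F N K s) δ ∧
      cflAvgRate F N K s δ (1 / (K : ℝ)) = avgRate (cflPrefetching F N K) δ ∧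
      ∀ M ∈ Set.Icc (0 : ℝ) (1 / (K : ℝ)),
        cflAvgRate F N K s δ M =
          lowerConvexEnvelope {((0 : ℝ), cflAvgRate F N K s δ 0),
            (1 / (K : ℝ), cflAvgRate F N K s δ (1 / (K : ℝ)))} M) := by
  have hK : 1 ≤ K := hN.trans hNK
  have hK' : (0 : ℝ) < K := by exact_mod_cast hK
  refine ⟨?_, fun d => isLeast_deliveryRates_cflPrefetching d δ, ?_, ?_⟩
  · exact Finset.expect_congr rfl fun d _ => (isLeast_deliveryRates_cflPrefetching d δ).csInf_eq
  · rintro d k rfl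
    refine ⟨cflDelivery_isDelivery_zero d, card_cflTransmissions d, ?_,
      fun G hG => (cflDelivery_isDelivery_zero d).mul_isGeneratorMatrix hG⟩
    rw [← card_cflTransmissions d, ← Fintype.card_coe]
    exact exists_isGeneratorMatrix_shortestLength (by omega)
  · intro s _
    have h0 : cflAvgRate F N K s δ 0 = avgRate (noPrefetching F N K s) δ := by
      rw [cflAvgRate_eq hK ⟨le_rfl, by positivity⟩]
      ring
    have h1 : cflAvgRate F N K s δ (1 / (K : ℝ)) = avgRate (cflPrefetching F N K) δ := by
      rw [cflAvgRate_eq hK ⟨by positivity, le_rfl⟩, mul_one_div_cancel hK'.ne']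
      ring
    refine ⟨h0, h1, fun M hM => ?_⟩
    rw [lowerConvexEnvelope_pair (by positivity) hM, h0, h1, cflAvgRate_eq hK hM, div_div_eq_mul_div,
      div_one, mul_comm M]
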